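/- Let $F,f\colon\mathbb R^n\times\mathbb R^m\to\mathbb R$ and $h_1,\dots,h_p\colon\mathbb R^n\times\mathbb R^m\to\mathbb R$ be continuously differentiable, let $I=\{1,\dots,\ell\}$ and $J=\{\ell+1,\dots,p\}$, and let $X\subset\mathbb R^n$. For $x\in\mathbb R^n$ put $$\Gamma(x)=\{y\in\mathbb R^m\mid h_i(x,y)\le 0\ (i\in I),\ h_i(x,y)=0\ (i\in J)\},\qquad \operatorname{dom}\Gamma=\{x\mid\Gamma(x)\ne\varnothing\},$$ $$S(x)=\operatorname{argmin}_y\{f(x,y)\mid y\in\Gamma(x)\},\qquad \varphi(x)=\inf_y\{f(x,y)\mid y\in\Gamma(x)\},\qquad h_0(x,y)=f(x,y)-\varphi(x),$$ so that $S(x)=\{y\in\mathbb R^m\mid h_i(x,y)\le 0\ (i\in I\cup\{0\}),\ h_i(x,y)=0\ (i\in J)\}$. A pair of finite families $((a^i)_{i\in I_1},(b^i)_{i\in I_2})$ in $\mathbb R^m$ is called positive-linearly dependent if $\sum_{i\in I_1}\alpha_ia^i+\sum_{i\in I_2}\beta_ib^i=0$ for some reals $\alpha_i\ge 0$ and $\beta_i\in\mathbb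 R$ that do not all vanish. For $(\bar x,\bar y)$ with $\bar y\in S(\bar x)$, we say that RCPLD$_S$ w.r.t. $\operatorname{dom}\Gamma$ (the relaxed constant positive linear dependence constraint qualification for the above description of $S$) holds at $(\bar x,\bar y)$ if there are a neighborhood $U$ of $(\bar x,\bar y)$ and an index set $\mathcal S\subset J$ such that 1. the family $(\nabla_yh_i(\bar x,\bar y))_{i\in\mathcal S}$ is a basis of the span of $\{\nabla_yh_i(\bar x,\bar y)\mid i\in J\}$; 2. the family $(\nabla_yh_i(x,y))_{i\in J}$ has constant rank on $U\cap(\operatorname{dom}\Gamma\times\mathbb R^m)$; 3. for each $K\subset\{i\in I\cup\{0\}\mid h_i(\bar x,\bar y)=0\}$ such that the pair of families $((\nabla_yh_i(\bar x,\bar y))_{i\in K},(\nabla_yh_i(\bar x,\bar y))_{i\in\mathcal S})$ is positive-linearly dependent, the family $(\nabla_yh_i(x,y))_{i\in K\cup\mathcal S}$ is linearly dependent for each $(x,y)\in U\cap(\operatorname{dom}\Gamma\times\mathbb R^m)$. **Theorem.** Assume that, for each $x\in\mathbb R^n$, the functions $f(x,\cdot)$ and $h_i(x,\cdot)$, $i\in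 I$, are convex and the functions $h_i(x,\cdot)$, $i\in J$, are affine. Let $X$ be nonempty and compact with $X\subset\operatorname{dom}\Gamma$, and let $\Gamma$ be locally bounded at each $\bar x\in X$, i.e., there are a bounded set $B\subset\mathbb R^m$ and a neighborhood $V$ of $\bar x$ with $\Gamma(x)\subset B$ for all $x\in V$. Suppose that RCPLD$_S$ w.r.t. $\operatorname{dom}\Gamma$ holds at each point $(\bar x,\bar y)$ with $\bar x\in X$ and $\bar y\in S(\bar x)$. Then the pessimistic bilevel problem $$\min_x\{\varphi_p(x)\mid x\in X\},\qquad \varphi_p(x)=\sup_y\{F(x,y)\mid y\in S(x)\},$$ has a solution, i.e., there is $\bar x\in X$ with $\varphi_p(\bar x)\le\varphi_p(x)$ for all $x\in X$. -/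

import Mathlib

namespace Bilevel

section General

variable {V ι κ : Type*}

/-- The pair of families `(a, b)` is positive-linearly dependent: there are scalars
`α i ≥ 0` and `β j` of arbitrary sign, not all vanishing, with `∑ α i a i + ∑ β j b j = 0`. -/
def PosLinDep [AddCommGroup V] [Module ℝ V] [Fintype ι] [Fintype κ]
    (a : ι → V) (b : κ → V) : Prop :=
  ∃ (α : ι → ℝ) (β : κ → ℝ), (∀ i, 0 ≤ α i) ∧ (α ≠ 0 ∨ β ≠ 0) ∧
    ∑ i, α i • a i + ∑ j, β j • b j = 0

end General

/-- `ℝᵏ` with the Euclidean norm. -/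
abbrev E (k : ℕ) : Type := EuclideanSpace ℝ (Fin k)

section SetValued

variable {n m : ℕ}

/-- Graph of a set-valued mapping. -/
def gph (Υ : E n → Set (E m)) : Set (E n × E m) := {z | z.2 ∈ Υ z.1}

/-- Domain of a set-valued mapping. -/
def dom (Υ : E n → Set (E m)) : Set (E n) := {x | (Υ x).Nonempty}

/-- Local boundedness of a set-valued mapping at `x₀`. -/
def LocallyBoundedAt (Υ : E n → Set (E m)) (x₀ : E n) : Prop :=
  ∃ B : Set (E m), Bornology.IsBounded B ∧ ∃ U ∈ nhds x₀, ∀ x ∈ U, Υ x ⊆ B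

end SetValued

section Systems

variable {n m : ℕ} {ι κ : Type*}

/-- The set-valued mapping `x ↦ {y | g i x y ≤ 0 for all i, e j x y = 0 for all j}` given by a
parametric system of inequalities `g` and equations `e`. -/
def feasible (g : ι → E n → E m → ℝ) (e : κ → E n → E m → ℝ) (x : E n) : Set (E m) :=
  {y | (∀ i, g i x y ≤ 0) ∧ ∀ j, e j x y = 0}

/-- The partial gradient of `h` with respect to the second variable at `(x, y)`. -/
noncomputable def gradY (h : E n → E m → ℝ) (x : E n) (y : E m) : E m :=
  gradient (fun y' => h x y') y

/-- The relaxed constant positive linear dependence constraint qualification for the system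
`g ≤ 0`, `e = 0` at `(x₀, y₀)` with respect to the set `Ω` of parameters. -/
def RCPLD (g : ι → E n → E m → ℝ) (e : κ → E n → E m → ℝ) (Ω : Set (E n))
    (x₀ : E n) (y₀ : E m) : Prop :=
  ∃ U ∈ nhds (x₀, y₀), ∃ S : Finset κ,
    -- the gradients of the equations in `S` form a basis of the span of all of them
    (LinearIndependent ℝ (fun j : S => gradY (e j) x₀ y₀) ∧
      Submodule.span ℝ (Set.range fun j : S => gradY (e j) x₀ y₀) =
        Submodule.span ℝ (Set.range fun j : κ => gradY (e j) x₀ y₀)) ∧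
    -- the family of gradients of the equations has constant rank
    (∃ r : ℕ, ∀ z ∈ U ∩ Ω ×ˢ Set.univ,
      Module.finrank ℝ (Submodule.span ℝ (Set.range fun j : κ => gradY (e j) z.1 z.2)) = r) ∧
    -- positive linear dependence at the reference point entails linear dependence nearby
    ∀ K : Finset ι, (∀ i ∈ K, g i x₀ y₀ = 0) →
      PosLinDep (fun i : K => gradY (g i) x₀ y₀) (fun j : S => gradY (e j) x₀ y₀) →
      ∀ z ∈ U ∩ Ω ×ˢ Set.univ,
        ¬ LinearIndependent ℝ
          (Sum.elim (fun i : K => gradY (g i) z.1 z.2) (fun j : S => gradY (e j) z.1 z.2))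

/-- The solution mapping `x ↦ argmin {f x y | y ∈ Γ x}`. -/
def solMap (f : E n → E m → ℝ) (Γ : E n → Set (E m)) (x : E n) : Set (E m) :=
  {y | y ∈ Γ x ∧ IsMinOn (f x) (Γ x) y}

/-- The optimal value function `x ↦ inf {f x y | y ∈ Γ x}`, with extended real values. -/
noncomputable def optVal (f : E n → E m → ℝ) (Γ : E n → Set (E m)) (x : E n) : EReal :=
  ⨅ y ∈ Γ x, (f x y : EReal)

/-- The function `h₀ x y = f x y - φ x`, where `φ` is the optimal value function.  It is used
only at and near parameters where `φ` is finite. -/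
noncomputable def valueGap (f : E n → E m → ℝ) (Γ : E n → Set (E m)) (x : E n) (y : E m) : ℝ :=
  f x y - (optVal f Γ x).toReal

/-- The inequality constraints of the solution mapping of `min {f x y | g x y ≤ 0, e x y = 0}`:
those of the feasible set mapping and, at the additional index `none`, the constraint
`f x y - φ x ≤ 0`. -/
noncomputable def solIneq (f : E n → E m → ℝ) (g : ι → E n → E m → ℝ)
    (e : κ → E n → E m → ℝ) : Option ι → E n → E m → ℝ
  | none => valueGap f (feasible g e)
  | some i => g i

/-- The objective function `φ_p x = sup {F x y | y ∈ S x}` of the pessimistic bilevel problem. -/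
noncomputable def pessVal (F : E n → E m → ℝ) (S : E n → Set (E m)) (x : E n) : EReal :=
  ⨆ y ∈ S x, (F x y : EReal)

/-- `x₀` is a (global) solution of `min {φ_p x | x ∈ X}`. -/
def IsPessimisticSolution (F : E n → E m → ℝ) (S : E n → Set (E m)) (X : Set (E n))
    (x₀ : E n) : Prop :=
  x₀ ∈ X ∧ IsMinOn (pessVal F S) X x₀

end Systems

end Bilevel

/-! A lower semicontinuous function attains its minimum on the compact set `X`, so it suffices that
`S` is inner semicontinuous relative to `X` (`lowerSemicontinuousOn_pessVal`). On `X`, the set `S x`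
is the solution set of a solvable convex system, with `h₀ ≤ 0` among its inequalities, and
`RCPLD.eventually_feasible_inter_nonempty` treats such systems.

Suppose that for `x` near `x₀` the system has no solution in the `ε`-ball around `y₀`. Minimize the
squared violation over the ball. As the convex system is solvable somewhere, the gradient at the
minimizer `w` is nonzero; so `w` lies on the sphere and `y₀ - w` is a combination of gradients of
constraints violated at `w`. Carathéodory makes the gradients in use linearly independent; by RCPLD
they are then positive-linearly independent at `(x₀, y₀)`, which bounds the coefficients by `ε / c`.
Convexity now bounds `ε ^ 2 = ‖y₀ - w‖ ^ 2` by a constant times the violation at `y₀`, which tends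
to 0: a contradiction. -/

namespace Bilevel

/-! ### Conic combinations and positive linear independence -/

section LinearAlgebra

variable {V ι κ : Type*} [Fintype κ]

/-- Conic Carathéodory theorem modulo a linearly independent family: a conic combination of the
`a i` plus a linear combination of the `b j` can be rewritten so that the vectors in use are
linearly independent. -/
theorem exists_linearIndependent_conic_combination [AddCommGroup V] [Module ℝ V]
    {a : ι → V} {b : κ → V} (hb : LinearIndependent ℝ b) (K : Finset ι)
    (lam : ι → ℝ) (hlam : ∀ i ∈ K, 0 ≤ lam i) (mu : κ → ℝ) :
    ∃ K' ⊆ K, LinearIndependent ℝ (Sum.elim (fun i : K' => a i) b) ∧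
      ∃ (α : ι → ℝ) (β : κ → ℝ), (∀ i ∈ K', 0 ≤ α i) ∧
        ∑ i ∈ K', α i • a i + ∑ j, β j • b j = ∑ i ∈ K, lam i • a i + ∑ j, mu j • b j := by
  classical
  induction K using Finset.strongInduction generalizing lam mu with
  | H K ih =>
    by_cases hli : LinearIndependent ℝ (Sum.elim (fun i : K => a i) b)
    · exact ⟨K, subset_rfl, hli, lam, mu, hlam, rfl⟩
    -- A relation can be negated, and one vanishing on all of `K` would be a relation among the
    -- independent `b j`.
    obtain ⟨γ, δ, hrel, i₁, hi₁, hpos⟩ : ∃ (γ : ι → ℝ) (δ : κ → ℝ),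
        ∑ i ∈ K, γ i • a i + ∑ j, δ j • b j = 0 ∧ ∃ i ∈ K, 0 < γ i := by
      rw [Fintype.not_linearIndependent_iff] at hli
      obtain ⟨G, hG, hne⟩ := hli
      set γ : ι → ℝ := fun i => if h : i ∈ K then G (Sum.inl ⟨i, h⟩) else 0 with hγ
      have hsum : ∑ i ∈ K, γ i • a i + ∑ j, G (Sum.inr j) • b j = 0 := by
        rw [Fintype.sum_sum_type] at hG
        rw [← hG, ← Finset.sum_coe_sort K]
        simp [hγ]
      by_cases hp : ∃ i ∈ K, 0 < γ i
      · exact ⟨γ, _, hsum, hp⟩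
      by_cases hn : ∃ i ∈ K, 0 < -γ i
      · refine ⟨fun i => -γ i, fun j => -G (Sum.inr j), ?_, hn⟩
        simp only [neg_smul, Finset.sum_neg_distrib]
        rw [← neg_add, hsum, neg_zero]
      exfalso
      push Not at hp hn
      have hz : ∀ i ∈ K, γ i = 0 := fun i hi => le_antisymm (hp i hi) (by linarith [hn i hi])
      rw [Finset.sum_eq_zero (fun i hi => by rw [hz i hi, zero_smul]), zero_add] at hsum
      obtain ⟨i | j, hi⟩ := hne
      · apply hi
        simpa [hγ] using hz i i.2
      · exact hi (Fintype.linearIndependent_iff.mp hb _ hsum j)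
    -- Ratio test: subtracting `t` times the relation, with the smallest ratio as `t`, keeps all
    -- coefficients on `K` nonnegative and kills the one at `i₀`.
    obtain ⟨i₀, hi₀, hmin⟩ := Finset.exists_min_image (K.filter fun i => 0 < γ i)
      (fun i => lam i / γ i) ⟨i₁, by simp [hi₁, hpos]⟩
    rw [Finset.mem_filter] at hi₀
    set t := lam i₀ / γ i₀ with ht
    have ht0 : 0 ≤ t := div_nonneg (hlam _ hi₀.1) hi₀.2.le
    obtain ⟨K', hK', hli', α, β, hα, heq⟩ := ih (K.erase i₀) (Finset.erase_ssubset hi₀.1)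
      (fun i => lam i - t * γ i) (fun i hi => by
        have hiK := Finset.mem_of_mem_erase hi
        rcases le_or_gt (γ i) 0 with h | h
        · nlinarith [hlam i hiK]
        · have := hmin i (by simp [hiK, h])
          rw [le_div_iff₀ h] at this
          linarith) (fun j => mu j - t * δ j)
    refine ⟨K', hK'.trans (Finset.erase_subset _ _), hli', α, β, hα, heq.trans ?_⟩
    have h0 : lam i₀ - t * γ i₀ = 0 := by rw [ht, div_mul_cancel₀ _ hi₀.2.ne', sub_self]
    have h1 : ∑ i ∈ K.erase i₀, (lam i - t * γ i) • a i = ∑ i ∈ K, (lam i - t * γ i) • a i := by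
      rw [← Finset.add_sum_erase K _ hi₀.1, h0, zero_smul, zero_add]
    rw [h1]
    simp only [sub_smul, Finset.sum_sub_distrib, mul_smul, ← Finset.smul_sum]
    have h2 : t • (∑ i ∈ K, γ i • a i + ∑ j, δ j • b j) = 0 := by rw [hrel, smul_zero]
    rw [smul_add] at h2
    rw [sub_add_sub_comm, h2, sub_zero]

/-- Families near a positive-linearly independent pair admit a uniform bound of the coefficients of
their combinations. -/
theorem exists_forall_norm_le_of_not_posLinDep [Fintype ι] [NormedAddCommGroup V]
    [NormedSpace ℝ V] {a₀ : ι → V} {b₀ : κ → V} (h : ¬ PosLinDep a₀ b₀) :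
    ∃ c > 0, ∀ᶠ p in nhds (a₀, b₀), ∀ (α : ι → ℝ) (β : κ → ℝ), (∀ i, 0 ≤ α i) →
      c * ‖(α, β)‖ ≤ ‖∑ i, α i • p.1 i + ∑ j, β j • p.2 j‖ := by
  -- By homogeneity normalized coefficients suffice. They form a compact set, so half of a positive
  -- lower bound on it survives small perturbations of the vectors.
  set T : Set ((ι → ℝ) × (κ → ℝ)) := Metric.sphere 0 1 ∩ {u | ∀ i, 0 ≤ u.1 i} with hT
  have hTc : IsCompact T := by
    refine (isCompact_sphere _ _).inter_right ?_
    simp only [Set.ofPred_forall]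
    exact isClosed_iInter fun i => isClosed_le continuous_const (by fun_prop)
  obtain ⟨c₀, hc₀, hle⟩ := hTc.exists_forall_le' (a := 0)
    (f := fun u => ‖∑ i, u.1 i • a₀ i + ∑ j, u.2 j • b₀ j‖) (by fun_prop) (by
      rintro ⟨α, β⟩ ⟨hu, hα⟩
      rw [norm_pos_iff]
      intro hz
      refine h ⟨α, β, hα, ?_, hz⟩
      by_contra! hne
      obtain ⟨rfl, rfl⟩ := hne
      simp at hu)
  refine ⟨c₀ / 2, by positivity, ?_⟩
  have htube : ∀ᶠ p in nhds (a₀, b₀), ∀ u ∈ T,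
      c₀ / 2 < ‖∑ i, u.1 i • p.1 i + ∑ j, u.2 j • p.2 j‖ := by
    refine hTc.eventually_forall_of_forall_eventually fun u hu => ?_
    have hcont : Continuous fun z : ((ι → V) × (κ → V)) × ((ι → ℝ) × (κ → ℝ)) =>
        ‖∑ i, z.2.1 i • z.1.1 i + ∑ j, z.2.2 j • z.1.2 j‖ := by fun_prop
    exact hcont.continuousAt.eventually (lt_mem_nhds (by
      have := hle u hu
      show c₀ / 2 < ‖∑ i, u.1 i • a₀ i + ∑ j, u.2 j • b₀ j‖
      linarith))
  filter_upwards [htube] with p hp α β hα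
  rcases eq_or_ne (α, β) 0 with h0 | h0
  · rw [h0]; simp
  have hn : 0 < ‖(α, β)‖ := norm_pos_iff.mpr h0
  have := hp (‖(α, β)‖⁻¹ • (α, β)) ⟨by
      rw [mem_sphere_zero_iff_norm, norm_smul, norm_inv, norm_norm, inv_mul_cancel₀ hn.ne'],
    fun i => mul_nonneg (inv_nonneg.mpr hn.le) (hα i)⟩
  have heq : ∑ i, (‖(α, β)‖⁻¹ • (α, β)).1 i • p.1 i + ∑ j, (‖(α, β)‖⁻¹ • (α, β)).2 j • p.2 j
      = ‖(α, β)‖⁻¹ • (∑ i, α i • p.1 i + ∑ j, β j • p.2 j) := by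
    simp [smul_add, Finset.smul_sum, mul_smul]
  rw [heq, norm_smul, norm_inv, norm_norm, ← div_eq_inv_mul, lt_div_iff₀ hn] at this
  exact this.le

end LinearAlgebra

/-! ### Gradients of convex and affine functions -/

section Convex

open InnerProductSpace

variable {V ι κ : Type*} [NormedAddCommGroup V] [InnerProductSpace ℝ V] [CompleteSpace V]

/-- On the segment from `w` to `z`, the slope of a convex function over `[0, 1]` dominates its
derivative at 0. -/
theorem _root_.ConvexOn.inner_gradient_le {h : V → ℝ} (hc : ConvexOn ℝ Set.univ h) {w : V}
    (hd : DifferentiableAt ℝ h w) (z : V) : inner ℝ (gradient h w) (z - w) ≤ h z - h w := by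
  have hline : ConvexOn ℝ Set.univ (h ∘ AffineMap.lineMap (k := ℝ) w z) := by
    simpa using hc.comp_affineMap (AffineMap.lineMap (k := ℝ) w z)
  have hder : HasDerivAt (h ∘ AffineMap.lineMap (k := ℝ) w z)
      (inner ℝ (gradient h w) (z - w)) 0 := by
    have h1 : HasFDerivAt h (toDual ℝ V (gradient h w)) (AffineMap.lineMap (k := ℝ) w z 0) := by
      simpa using hd.hasGradientAt.hasFDerivAt
    simpa using h1.comp_hasDerivAt (0 : ℝ) (AffineMap.hasDerivAt_lineMap (a := w) (b := z))
  simpa [slope] using hline.le_slope_of_hasDerivAt (Set.mem_univ _) (Set.mem_univ _)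
    zero_lt_one hder

theorem inner_gradient_eq_of_affine {h : V → ℝ} (ha : ∃ A : V →ᵃ[ℝ] ℝ, ∀ y, h y = A y) {w : V}
    (hd : DifferentiableAt ℝ h w) (z : V) : inner ℝ (gradient h w) (z - w) = h z - h w := by
  have hconv : ∀ A : V →ᵃ[ℝ] ℝ, ConvexOn ℝ Set.univ A := fun A => by
    simpa using (convexOn_id (𝕜 := ℝ) (convex_univ (E := ℝ))).comp_affineMap A
  obtain ⟨A, hA⟩ := ha
  obtain rfl : h = A := funext hA
  refine le_antisymm ((hconv A).inner_gradient_le hd z) ?_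
  have h2 := (hconv (-A)).inner_gradient_le (w := w) (by simpa using hd.neg) z
  have h3 : gradient (⇑(-A)) w = -gradient (⇑A) w :=
    HasGradientAt.gradient (by
      rw [hasGradientAt_iff_hasFDerivAt, map_neg]
      exact hd.hasGradientAt.hasFDerivAt.neg)
  rw [h3, inner_neg_left] at h2
  simp only [AffineMap.coe_neg, Pi.neg_apply] at h2
  linarith

/-- Squaring removes the kink at 0: in every sign case the first-order remainder is at most `(s - t)
^ 2`. -/
theorem hasDerivAt_posPart_sq (t : ℝ) :
    HasDerivAt (fun s : ℝ => (max s 0) ^ 2) (2 * max t 0) t := by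
  rw [hasDerivAt_iff_isLittleO]
  refine Asymptotics.IsBigO.trans_isLittleO ?_
    (Asymptotics.isLittleO_pow_sub_sub t (show 1 < 2 by norm_num))
  refine Asymptotics.IsBigO.of_bound 1 (Filter.Eventually.of_forall fun s => ?_)
  simp only [norm_pow, one_mul, Real.norm_eq_abs, sq_abs, smul_eq_mul]
  rw [abs_le]
  rcases max_cases s 0 with ⟨h1, h2⟩ | ⟨h1, h2⟩ <;> rcases max_cases t 0 with ⟨h3, h4⟩ | ⟨h3, h4⟩ <;>
    rw [h1, h3] <;> constructor <;> nlinarith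

end Convex
end Bilevel

namespace Bilevel

/-! ### Squared violation of a system -/

section Violation

variable {V ι κ : Type*} [Fintype ι] [Fintype κ]

/-- The squared violation of the system `g ≤ 0`, `e = 0`. -/
def sqViolation (g : ι → V → ℝ) (e : κ → V → ℝ) (y : V) : ℝ :=
  ∑ i, max (g i y) 0 ^ 2 + ∑ j, e j y ^ 2

variable {g : ι → V → ℝ} {e : κ → V → ℝ}

theorem sqViolation_nonneg (y : V) : 0 ≤ sqViolation g e y := by
  unfold sqViolation; positivity

theorem posPart_sq_le_sqViolation (i : ι) (y : V) : max (g i y) 0 ^ 2 ≤ sqViolation g e y :=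
  (Finset.single_le_sum (f := fun i => max (g i y) 0 ^ 2) (fun _ _ => sq_nonneg _)
    (Finset.mem_univ i)).trans (le_add_of_nonneg_right (Finset.sum_nonneg fun _ _ => sq_nonneg _))

theorem sq_le_sqViolation (j : κ) (y : V) : e j y ^ 2 ≤ sqViolation g e y :=
  (Finset.single_le_sum (f := fun j => e j y ^ 2) (fun _ _ => sq_nonneg _)
    (Finset.mem_univ j)).trans (le_add_of_nonneg_left (Finset.sum_nonneg fun _ _ => sq_nonneg _))

end Violation

/-! ### Minimizing the violation over a ball -/

section Convex

variable {V ι κ : Type*} [NormedAddCommGroup V] [InnerProductSpace ℝ V]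

/-- A minimizer over a ball at which the gradient does not vanish lies on the sphere, and the
gradient there points away from the centre. -/
theorem norm_eq_and_sub_eq_of_isMinOn_closedBall [CompleteSpace V] {P : V → ℝ} {y w d : V} {ε : ℝ}
    (hε : 0 < ε) (hw : w ∈ Metric.closedBall y ε) (hmin : IsMinOn P (Metric.closedBall y ε) w)
    (hP : HasGradientAt P d w) (hd : d ≠ 0) : ‖y - w‖ = ε ∧ y - w = (ε / ‖d‖) • d := by
  have hd' : 0 < ‖d‖ := norm_pos_iff.mpr hd
  have hle : ‖y - w‖ ≤ ε := by rwa [← dist_eq_norm, dist_comm]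
  -- `v` minimizes `inner ℝ d ·` over the ball. Testing the optimality of `w` against it forces
  -- equality in Cauchy–Schwarz for `d` and `y - w`.
  set v : V := y - (ε / ‖d‖) • d with hv
  have hvmem : v ∈ Metric.closedBall y ε := by
    rw [Metric.mem_closedBall, dist_eq_norm, hv, sub_sub_cancel_left, norm_neg, norm_smul,
      Real.norm_of_nonneg (by positivity), div_mul_cancel₀ _ hd'.ne']
  have hinner : 0 ≤ inner ℝ d (v - w) :=
    hmin.localize.hasFDerivWithinAt_nonneg hP.hasFDerivAt.hasFDerivWithinAt
      (sub_mem_posTangentConeAt_of_segment_subset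
        ((convex_closedBall y ε).segment_subset hw hvmem))
  have hvw : v - w = (y - w) - (ε / ‖d‖) • d := by rw [hv]; abel
  rw [hvw, inner_sub_right, inner_smul_right, real_inner_self_eq_norm_sq] at hinner
  have h1 : ε / ‖d‖ * ‖d‖ ^ 2 = ‖d‖ * ε := by field_simp
  rw [h1] at hinner
  have hcs := real_inner_le_norm d (y - w)
  have hge : ε ≤ ‖y - w‖ := le_of_mul_le_mul_left (by linarith) hd'
  have hnorm : ‖y - w‖ = ε := le_antisymm hle hge
  refine ⟨hnorm, ?_⟩
  have heq : inner ℝ d (y - w) = ‖d‖ * ‖y - w‖ := le_antisymm hcs (by rw [hnorm]; linarith)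
  rw [inner_eq_norm_mul_iff_real, hnorm] at heq
  rw [div_eq_inv_mul, mul_smul, heq, smul_smul, inv_mul_cancel₀ hd'.ne', one_smul]

variable [Fintype ι] [Fintype κ] {g : ι → V → ℝ} {e : κ → V → ℝ}

theorem hasGradientAt_sqViolation [CompleteSpace V] {w : V}
    (hg : ∀ i, DifferentiableAt ℝ (g i) w) (he : ∀ j, DifferentiableAt ℝ (e j) w) :
    HasGradientAt (sqViolation g e)
      (∑ i, (2 * max (g i w) 0) • gradient (g i) w + ∑ j, (2 * e j w) • gradient (e j) w) w := by
  rw [hasGradientAt_iff_hasFDerivAt, map_add, map_sum, map_sum]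
  refine HasFDerivAt.add (HasFDerivAt.fun_sum fun i _ => ?_) (HasFDerivAt.fun_sum fun j _ => ?_)
  · rw [map_smul]
    exact (hasDerivAt_posPart_sq (g i w)).comp_hasFDerivAt w (hg i).hasGradientAt.hasFDerivAt
  · rw [map_smul]
    have hsq : HasDerivAt (fun s : ℝ => s ^ 2) (2 * e j w) (e j w) := by
      simpa using hasDerivAt_pow 2 (e j w)
    exact hsq.comp_hasFDerivAt w (he j).hasGradientAt.hasFDerivAt

/-- If a solvable convex system has no solution in a ball, there is a point on the sphere with
smaller violation than the centre, from which the direction to the centre is a combination of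
gradients of constraints violated there. -/
theorem exists_sub_eq_of_disjoint_closedBall [ProperSpace V]
    (hgd : ∀ i, Differentiable ℝ (g i)) (hed : ∀ j, Differentiable ℝ (e j))
    (hgc : ∀ i, ConvexOn ℝ Set.univ (g i)) (hea : ∀ j, ∃ A : V →ᵃ[ℝ] ℝ, ∀ y, e j y = A y)
    {y z : V} {ε : ℝ} (hε : 0 < ε) (hzg : ∀ i, g i z ≤ 0) (hze : ∀ j, e j z = 0)
    (hdisj : ∀ w ∈ Metric.closedBall y ε, ¬ ((∀ i, g i w ≤ 0) ∧ ∀ j, e j w = 0)) :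
    ∃ w : V, ‖y - w‖ = ε ∧ sqViolation g e w ≤ sqViolation g e y ∧
      ∃ (lam : ι → ℝ) (mu : κ → ℝ), (∀ i, 0 ≤ lam i) ∧ (∀ i, 0 < lam i → 0 < g i w) ∧
        y - w = ∑ i, lam i • gradient (g i) w + ∑ j, mu j • gradient (e j) w := by
  have hdiff : ∀ w, HasGradientAt (sqViolation g e)
      (∑ i, (2 * max (g i w) 0) • gradient (g i) w + ∑ j, (2 * e j w) • gradient (e j) w) w :=
    fun w => hasGradientAt_sqViolation (fun i => hgd i w) (fun j => hed j w)
  have hcont : Continuous (sqViolation g e) :=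
    continuous_iff_continuousAt.mpr fun w => (hdiff w).differentiableAt.continuousAt
  obtain ⟨w, hw, hmin⟩ := (isCompact_closedBall y ε).exists_isMinOn
    ⟨y, Metric.mem_closedBall_self hε.le⟩ hcont.continuousOn
  have hpos : 0 < sqViolation g e w := by
    refine (sqViolation_nonneg w).lt_of_ne fun h0 => hdisj w hw ⟨fun i => ?_, fun j => ?_⟩
    · have h1 := posPart_sq_le_sqViolation (g := g) (e := e) i w
      rw [← h0] at h1
      exact max_eq_right_iff.mp (pow_eq_zero_iff two_ne_zero |>.mp (le_antisymm h1 (sq_nonneg _)))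
    · have h1 := sq_le_sqViolation (g := g) (e := e) j w
      rw [← h0] at h1
      exact pow_eq_zero_iff two_ne_zero |>.mp (le_antisymm h1 (sq_nonneg _))
  set d := ∑ i, (2 * max (g i w) 0) • gradient (g i) w + ∑ j, (2 * e j w) • gradient (e j) w
    with hd
  have hd0 : d ≠ 0 := by
    intro h0
    -- The gradient inequalities towards the solution `z`, weighted by the violations, show that `z
    -- - w` is a strict descent direction.
    have hin : inner ℝ d (z - w) ≤ -(2 * sqViolation g e w) := by
      rw [hd, inner_add_left, sum_inner, sum_inner, sqViolation, mul_add, neg_add,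
        Finset.mul_sum, Finset.mul_sum, ← Finset.sum_neg_distrib, ← Finset.sum_neg_distrib]
      refine add_le_add (Finset.sum_le_sum fun i _ => ?_) (Finset.sum_le_sum fun j _ => ?_)
      · rw [real_inner_smul_left]
        have h1 := (hgc i).inner_gradient_le (hgd i w) z
        rcases max_cases (g i w) 0 with ⟨h2, h3⟩ | ⟨h2, h3⟩ <;> rw [h2]
        · nlinarith [hzg i]
        · simp
      · rw [real_inner_smul_left, inner_gradient_eq_of_affine (hea j) (hed j w), hze j]
        nlinarith
    rw [h0, inner_zero_left] at hin
    linarith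
  obtain ⟨hnorm, hsub⟩ := norm_eq_and_sub_eq_of_isMinOn_closedBall hε hw hmin (hdiff w) hd0
  have ht : 0 ≤ ε / ‖d‖ := by positivity
  refine ⟨w, hnorm, hmin (Metric.mem_closedBall_self hε.le),
    fun i => ε / ‖d‖ * (2 * max (g i w) 0), fun j => ε / ‖d‖ * (2 * e j w),
    fun i => by positivity, fun i hi => ?_, ?_⟩
  · by_contra! hle
    simp [max_eq_right hle] at hi
  · simp only [mul_smul, ← Finset.smul_sum, ← smul_add] at hsub hd ⊢
    rw [hsub, hd]

end Convex
end Bilevel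

namespace Bilevel

/-! ### Inner semicontinuity of convex systems under RCPLD -/

section InnerSemicontinuity

open Filter Topology

variable {n m : ℕ} {ι κ : Type*} [Fintype ι]
  {g : ι → E n → E m → ℝ} {e : κ → E n → E m → ℝ} {Ω : Set (E n)} {x₀ : E n} {y₀ : E m}

/-- Near the reference point, coefficients of combinations of gradients are controlled, uniformly
over all subfamilies that are positive-linearly independent at the reference point. -/
theorem exists_eventually_forall_finset_norm_le
    (hg : ∀ i, ContinuousAt (fun z : E n × E m => gradY (g i) z.1 z.2) (x₀, y₀))
    (he : ∀ j, ContinuousAt (fun z : E n × E m => gradY (e j) z.1 z.2) (x₀, y₀))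
    (S : Finset κ) :
    ∃ c > 0, ∀ᶠ z : E n × E m in 𝓝 (x₀, y₀), ∀ K : Finset ι,
      ¬ PosLinDep (fun i : K => gradY (g i) x₀ y₀) (fun j : S => gradY (e j) x₀ y₀) →
      ∀ (α : K → ℝ) (β : S → ℝ), (∀ i, 0 ≤ α i) →
        c * ‖(α, β)‖ ≤ ‖∑ i : K, α i • gradY (g i) z.1 z.2 + ∑ j : S, β j • gradY (e j) z.1 z.2‖ := by
  have hK : ∀ K : Finset ι, ∃ c > 0, ∀ᶠ z : E n × E m in 𝓝 (x₀, y₀),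
      ¬ PosLinDep (fun i : K => gradY (g i) x₀ y₀) (fun j : S => gradY (e j) x₀ y₀) →
      ∀ (α : K → ℝ) (β : S → ℝ), (∀ i, 0 ≤ α i) →
        c * ‖(α, β)‖ ≤
          ‖∑ i : K, α i • gradY (g i) z.1 z.2 + ∑ j : S, β j • gradY (e j) z.1 z.2‖ := by
    intro K
    by_cases h : PosLinDep (fun i : K => gradY (g i) x₀ y₀) (fun j : S => gradY (e j) x₀ y₀)
    · exact ⟨1, one_pos, Eventually.of_forall fun z hz => absurd h hz⟩
    obtain ⟨c, hc, hev⟩ := exists_forall_norm_le_of_not_posLinDep h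
    have hcont : ContinuousAt (fun z : E n × E m =>
        ((fun i : K => gradY (g i) z.1 z.2), (fun j : S => gradY (e j) z.1 z.2))) (x₀, y₀) :=
      (continuousAt_pi.mpr fun i : K => hg i).prodMk (continuousAt_pi.mpr fun j : S => he j)
    exact ⟨c, hc, (hcont.eventually hev).mono fun z hz _ => hz⟩
  choose c hc hev using hK
  obtain ⟨K₀, hK₀⟩ := Finite.exists_min c
  refine ⟨c K₀, hc K₀, ?_⟩
  filter_upwards [eventually_all.mpr hev] with z hz K hnot α β hα
  exact (mul_le_mul_of_nonneg_right (hK₀ K) (norm_nonneg _)).trans (hz K hnot α β hα)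

variable [Fintype κ]

/-- Only positive parts of the inequalities enter, so upper semicontinuity suffices; this is what
admits `h₀`. -/
theorem tendsto_sqViolation_of_mem_feasible
    (hg : ∀ i, UpperSemicontinuousWithinAt (fun x => g i x y₀) Ω x₀)
    (he : ∀ j, ContinuousWithinAt (fun x => e j x y₀) Ω x₀) (hy₀ : y₀ ∈ feasible g e x₀) :
    Tendsto (fun x => sqViolation (fun i => g i x) (fun j => e j x) y₀) (𝓝[Ω] x₀) (𝓝 0) := by
  have h1 : ∀ i, Tendsto (fun x => max (g i x y₀) 0) (𝓝[Ω] x₀) (𝓝 0) := fun i => by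
    refine tendsto_order.mpr ⟨fun a ha => Eventually.of_forall fun x => lt_max_of_lt_right ha,
      fun a ha => ?_⟩
    filter_upwards [hg i a ((hy₀.1 i).trans_lt ha)] with x hx using max_lt hx ha
  have h2 : ∀ j, Tendsto (fun x => e j x y₀) (𝓝[Ω] x₀) (𝓝 0) := fun j => by
    simpa only [ContinuousWithinAt, hy₀.2 j] using he j
  simpa [sqViolation] using (tendsto_finsetSum Finset.univ fun i _ => (h1 i).pow 2).add
    (tendsto_finsetSum Finset.univ fun j _ => (h2 j).pow 2)

/-- Pair `y - w` with itself. By convexity an inequality contributes at most `α i * (g i x y - g i x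
w) ≤ C * R`, since `g i x w ≥ 0`; an equation contributes at most `2 * (C * R)`. -/
theorem sq_norm_sub_le_of_combination
    (hgd : ∀ i x, Differentiable ℝ (g i x)) (hed : ∀ j x, Differentiable ℝ (e j x))
    (hgc : ∀ i x, ConvexOn ℝ Set.univ (g i x))
    (hea : ∀ j x, ∃ A : E m →ᵃ[ℝ] ℝ, ∀ y, e j x y = A y)
    {x : E n} {y w : E m} {K : Finset ι} {S : Finset κ} {α : K → ℝ} {β : S → ℝ} {C R : ℝ}
    (hR : 0 ≤ R) (hα : ∀ i, 0 ≤ α i) (hαC : ∀ i, α i ≤ C) (hβC : ∀ j, |β j| ≤ C) (hC : 0 ≤ C)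
    (hgw : ∀ i ∈ K, 0 ≤ g i x w) (hgy : ∀ i, g i x y ≤ R) (hey : ∀ j, |e j x y| ≤ R)
    (hew : ∀ j, |e j x w| ≤ R)
    (hsum : y - w = ∑ i : K, α i • gradY (g i) x w + ∑ j : S, β j • gradY (e j) x w) :
    ‖y - w‖ ^ 2 ≤ (Fintype.card ι + 2 * Fintype.card κ) * (C * R) := by
  have hCR : 0 ≤ C * R := mul_nonneg hC hR
  have h1 : ∑ i : K, inner ℝ (α i • gradY (g i) x w) (y - w) ≤ Fintype.card ι * (C * R) := by
    calc _ ≤ ∑ i : K, C * R := Finset.sum_le_sum fun i _ => by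
            rw [real_inner_smul_left]
            have h := (hgc i x).inner_gradient_le (hgd i x w) y
            calc _ ≤ α i * R := mul_le_mul_of_nonneg_left
                    (h.trans (by linarith [hgw i i.2, hgy i])) (hα i)
              _ ≤ C * R := mul_le_mul_of_nonneg_right (hαC i) hR
      _ = K.card * (C * R) := by simp
      _ ≤ _ := mul_le_mul_of_nonneg_right (by exact_mod_cast K.card_le_univ) hCR
  have h2 : ∑ j : S, inner ℝ (β j • gradY (e j) x w) (y - w) ≤
      2 * Fintype.card κ * (C * R) := by
    calc _ ≤ ∑ j : S, 2 * (C * R) := Finset.sum_le_sum fun j _ => by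
            rw [real_inner_smul_left, gradY,
              inner_gradient_eq_of_affine (hea j x) (hed j x w)]
            calc _ ≤ |β j| * |e j x y - e j x w| := (le_abs_self _).trans (abs_mul _ _).le
              _ ≤ C * (R + R) := mul_le_mul (hβC j)
                    ((abs_sub _ _).trans (add_le_add (hey j) (hew j))) (abs_nonneg _) hC
              _ = _ := by ring
      _ = 2 * S.card * (C * R) := by simp; ring
      _ ≤ _ := mul_le_mul_of_nonneg_right (by
            have : (S.card : ℝ) ≤ Fintype.card κ := by exact_mod_cast S.card_le_univ
            linarith) hCR
  calc ‖y - w‖ ^ 2 = inner ℝ (y - w) (y - w) := (real_inner_self_eq_norm_sq _).symm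
    _ = ∑ i : K, inner ℝ (α i • gradY (g i) x w) (y - w) +
        ∑ j : S, inner ℝ (β j • gradY (e j) x w) (y - w) := by
          rw [← sum_inner, ← sum_inner, ← inner_add_left, ← hsum]
    _ ≤ _ := by linarith

/-- Under RCPLD a solvable convex system depends inner semicontinuously on its parameter. -/
theorem RCPLD.eventually_feasible_inter_nonempty (hcq : RCPLD g e Ω x₀ y₀)
    (hgd : ∀ i x, Differentiable ℝ (g i x)) (hed : ∀ j x, Differentiable ℝ (e j x))
    (hgc : ∀ i x, ConvexOn ℝ Set.univ (g i x))
    (hea : ∀ j x, ∃ A : E m →ᵃ[ℝ] ℝ, ∀ y, e j x y = A y)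
    (hgg : ∀ i, ContinuousAt (fun z : E n × E m => gradY (g i) z.1 z.2) (x₀, y₀))
    (heg : ∀ j, ContinuousAt (fun z : E n × E m => gradY (e j) z.1 z.2) (x₀, y₀))
    (hgu : ∀ i, UpperSemicontinuousWithinAt (fun z : E n × E m => g i z.1 z.2)
      (Ω ×ˢ Set.univ) (x₀, y₀))
    (hec : ∀ j, ContinuousAt (fun z : E n × E m => e j z.1 z.2) (x₀, y₀))
    (hx₀ : x₀ ∈ Ω) (hy₀ : y₀ ∈ feasible g e x₀) (hne : ∀ x ∈ Ω, (feasible g e x).Nonempty)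
    {W : Set (E m)} (hW : W ∈ 𝓝 y₀) :
    ∀ᶠ x in 𝓝[Ω] x₀, (feasible g e x ∩ W).Nonempty := by
  classical
  obtain ⟨U, hU, S, ⟨hSli, hSspan⟩, ⟨r, hr⟩, hK⟩ := hcq
  obtain ⟨c, hc, hcoef⟩ := exists_eventually_forall_finset_norm_le hgg heg S
  have hfilter : 𝓝[Ω ×ˢ Set.univ] (x₀, y₀) = 𝓝[Ω] x₀ ×ˢ 𝓝 y₀ := by
    rw [nhdsWithin_prod_eq, nhdsWithin_univ]
  have hslice : Tendsto (fun x => (x, y₀)) (𝓝[Ω] x₀) (𝓝[Ω ×ˢ Set.univ] (x₀, y₀)) := by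
    rw [hfilter]
    exact tendsto_id.prodMk tendsto_const_nhds
  have hslice_cont : ∀ j, ContinuousWithinAt (fun x => e j x y₀) Ω x₀ := fun j =>
    (hec j).tendsto.comp (hslice.mono_right nhdsWithin_le_nhds)
  have hli : ∀ᶠ z : E n × E m in 𝓝 (x₀, y₀),
      LinearIndependent ℝ (fun j : S => gradY (e j) z.1 z.2) := by
    have hcont : ContinuousAt (fun z : E n × E m => fun j : S => gradY (e j) z.1 z.2) (x₀, y₀) :=
      continuousAt_pi.mpr fun j => heg j
    exact hcont.eventually (isOpen_setOfPred_linearIndependent.mem_nhds hSli)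
  have hinact : ∀ᶠ z in 𝓝[Ω ×ˢ Set.univ] (x₀, y₀), ∀ i, g i x₀ y₀ < 0 → g i z.1 z.2 < 0 := by
    refine eventually_all.mpr fun i => ?_
    by_cases h : g i x₀ y₀ < 0
    · exact (hgu i 0 h).mono fun z hz _ => hz
    · exact Eventually.of_forall fun z hz => absurd hz h
  have hall := (((hcoef.and hli).and hU).filter_mono nhdsWithin_le_nhds).and
    (hinact.and self_mem_nhdsWithin)
  rw [hfilter] at hall
  obtain ⟨A, hA, B, hB, hAB⟩ := mem_prod_iff.mp hall
  obtain ⟨ε, hε, hball⟩ := Metric.nhds_basis_closedBall.mem_iff.mp (inter_mem hB hW)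
  set N : ℝ := Fintype.card ι + 2 * Fintype.card κ with hN
  have hN0 : 0 ≤ N := by positivity
  -- Chosen so that the final estimate reads `ε ^ 2 ≤ N * (ε / c * δ) = ε ^ 2 * (N / (N + 1))`,
  -- which is absurd.
  set δ : ℝ := c * ε / (N + 1) with hδ
  have hδ0 : 0 < δ := by positivity
  have hviol := (tendsto_sqViolation_of_mem_feasible (Ω := Ω)
    (fun i a ha => hslice.eventually (hgu i a ha))
    hslice_cont hy₀).eventually
      (gt_mem_nhds (show 0 < δ ^ 2 by positivity))
  filter_upwards [hA, hviol, self_mem_nhdsWithin] with x hxA hxv hxΩ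
  by_contra hempty
  obtain ⟨z, hz⟩ := hne x hxΩ
  obtain ⟨w, hnorm, hviolw, lam, mu, hlam, hlamw, hsum⟩ := exists_sub_eq_of_disjoint_closedBall
    (fun i => hgd i x) (fun j => hed j x) (fun i => hgc i x) (fun j => hea j x) (y := y₀) hε
    hz.1 hz.2 (fun w hw hfeas => hempty ⟨w, hfeas, (hball hw).2⟩)
  have hwball : w ∈ Metric.closedBall y₀ ε := by
    rw [Metric.mem_closedBall, dist_comm, dist_eq_norm, hnorm]
  obtain ⟨⟨⟨hco, hSw⟩, hUw⟩, hact, hΩw⟩ := hAB (Set.mk_mem_prod hxA (hball hwball).1)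
  -- The gradients in `S` stay independent nearby and the full rank is constant, so `S` still
  -- indexes a basis and can carry the whole equation part.
  have hspan : Submodule.span ℝ (Set.range fun j : S => gradY (e j) x w) =
      Submodule.span ℝ (Set.range fun j : κ => gradY (e j) x w) := by
    refine Submodule.eq_of_le_of_finrank_eq (Submodule.span_mono ?_) ?_
    · rintro _ ⟨j, rfl⟩
      exact ⟨j, rfl⟩
    · rw [hr (x, w) ⟨hUw, hΩw⟩, ← hr (x₀, y₀) ⟨mem_of_mem_nhds hU, hx₀, Set.mem_univ _⟩,
        ← hSspan, finrank_span_eq_card hSw, finrank_span_eq_card hSli]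
  obtain ⟨mu', hmu'⟩ : ∃ mu' : S → ℝ, ∑ j, mu' j • gradY (e j) x w =
      ∑ j, mu j • gradY (e j) x w := by
    rw [← Submodule.mem_span_range_iff_exists_fun, hspan]
    exact Submodule.sum_mem _ fun j _ => Submodule.smul_mem _ _ (Submodule.subset_span ⟨j, rfl⟩)
  obtain ⟨K, hKsub, hKli, α, β, hα, hαβ⟩ := exists_linearIndependent_conic_combination hSw
    (a := fun i => gradY (g i) x w) (Finset.univ.filter fun i => 0 < lam i) lam
    (fun i _ => hlam i) mu'
  have hKpos : ∀ i ∈ K, 0 < g i x w := fun i hi =>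
    hlamw i (Finset.mem_filter.mp (hKsub hi)).2
  -- Constraints violated at `w` are active at `(x₀, y₀)`, because inactive ones stay negative
  -- nearby; the third RCPLD condition then applies in contrapositive form.
  have hnot : ¬ PosLinDep (fun i : K => gradY (g i) x₀ y₀) (fun j : S => gradY (e j) x₀ y₀) :=
    fun hpld => hK K (fun i hi => le_antisymm (hy₀.1 i) (not_lt.mp fun hlt =>
      (hact i hlt).not_gt (hKpos i hi))) hpld (x, w) ⟨hUw, hΩw⟩ hKli
  have hrepr : y₀ - w = ∑ i : K, α i • gradY (g i) x w + ∑ j : S, β j • gradY (e j) x w := by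
    rw [Finset.sum_coe_sort K (fun i => α i • gradY (g i) x w), hαβ, hmu', hsum,
      Finset.sum_filter_of_ne]
    · rfl
    · intro i _ hi
      exact (hlam i).lt_of_ne fun h0 => hi (by rw [← h0, zero_smul])
  have hbound := hco K hnot (fun i => α i) β (fun i => hα i i.2)
  rw [← hrepr, hnorm, mul_comm, ← le_div_iff₀ hc] at hbound
  have hsq := sq_norm_sub_le_of_combination hgd hed hgc hea (x := x) (C := ε / c) (R := δ)
    hδ0.le (fun i : K => hα i i.2)
    (fun i => (le_abs_self _).trans
      (((norm_le_pi_norm (fun i : K => α i) i).trans (le_max_left _ _)).trans hbound))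
    (fun j => ((norm_le_pi_norm β j).trans (le_max_right _ _)).trans hbound)
    (by positivity) (fun i hi => (hKpos i hi).le)
    (fun i => (le_max_left _ 0).trans (abs_le_of_sq_le_sq'
      ((posPart_sq_le_sqViolation (g := fun i => g i x) (e := fun j => e j x) i y₀).trans hxv.le)
      hδ0.le).2)
    (fun j => abs_le_of_sq_le_sq
      ((sq_le_sqViolation (g := fun i => g i x) (e := fun j => e j x) j y₀).trans hxv.le) hδ0.le)
    (fun j => abs_le_of_sq_le_sq
      ((sq_le_sqViolation (g := fun i => g i x) (e := fun j => e j x) j w).trans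
        (hviolw.trans hxv.le)) hδ0.le)
    hrepr
  rw [hnorm, ← hN] at hsq
  have h1 : N * (ε / c * δ) = ε ^ 2 * (N / (N + 1)) := by
    rw [hδ]; field_simp
  have h2 : N / (N + 1) < 1 := by rw [div_lt_one (by positivity)]; linarith
  rw [h1] at hsq
  nlinarith [sq_pos_of_pos hε]

end InnerSemicontinuity
end Bilevel

namespace Bilevel

/-! ### The solution mapping and the optimal value -/

section Solutions

open Filter Topology

variable {n m : ℕ} {ι κ : Type*} {f : E n → E m → ℝ} {g : ι → E n → E m → ℝ}
  {e : κ → E n → E m → ℝ} {Γ : E n → Set (E m)} {Ω : Set (E n)} {x₀ : E n} {y₀ : E m}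

theorem differentiable_slice {h : E n → E m → ℝ} (hh : ContDiff ℝ 1 (Function.uncurry h))
    (x : E n) : Differentiable ℝ (h x) :=
  (hh.differentiable one_ne_zero).comp (f := fun y => (x, y)) (by fun_prop)

theorem continuous_gradY {h : E n → E m → ℝ} (hh : ContDiff ℝ 1 (Function.uncurry h)) :
    Continuous fun z : E n × E m => gradY h z.1 z.2 := by
  have heq : ∀ z : E n × E m, gradY h z.1 z.2 = (InnerProductSpace.toDual ℝ (E m)).symm
      ((fderiv ℝ (Function.uncurry h) z).comp (ContinuousLinearMap.inr ℝ (E n) (E m))) :=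
    fun z => HasGradientAt.gradient <| by
      rw [hasGradientAt_iff_hasFDerivAt, LinearIsometryEquiv.apply_symm_apply]
      exact HasFDerivAt.comp (f := fun y => (z.1, y)) z.2
        (hh.differentiable one_ne_zero z).hasFDerivAt (hasFDerivAt_prodMk_right z.1 z.2)
  simp only [heq]
  exact (InnerProductSpace.toDual ℝ (E m)).symm.continuous.comp
    ((hh.continuous_fderiv one_ne_zero).clm_comp continuous_const)

/-- The optimal value is constant in `y`, so it needs no regularity here. -/
theorem gradY_valueGap (hf : ∀ x, Differentiable ℝ (f x)) (x : E n) (y : E m) :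
    gradY (valueGap f Γ) x y = gradY f x y :=
  HasGradientAt.gradient <| by
    rw [hasGradientAt_iff_hasFDerivAt]
    exact (hf x y).hasGradientAt.hasFDerivAt.sub_const _

theorem optVal_eq_of_mem_solMap {x : E n} {y : E m} (hy : y ∈ solMap f Γ x) :
    optVal f Γ x = (f x y : EReal) :=
  le_antisymm (iInf₂_le y hy.1) (le_iInf₂ fun _ hz => EReal.coe_le_coe_iff.mpr (hy.2 hz))

theorem valueGap_eq_of_mem_solMap {x : E n} {y : E m} (hy : y ∈ solMap f Γ x) (z : E m) :
    valueGap f Γ x z = f x z - f x y := by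
  rw [valueGap, optVal_eq_of_mem_solMap hy, EReal.toReal_coe]

/-- An attained optimal value is a real number, so `toReal` in `valueGap` loses nothing. -/
theorem feasible_solIneq_eq_solMap {x : E n} (hne : (solMap f (feasible g e) x).Nonempty) :
    feasible (solIneq f g e) e x = solMap f (feasible g e) x := by
  obtain ⟨y, hy⟩ := hne
  ext z
  have hgap := valueGap_eq_of_mem_solMap hy z
  constructor
  · rintro ⟨hz, hze⟩
    refine ⟨⟨fun i => hz (some i), hze⟩, fun v hv => ?_⟩
    have h0 : valueGap f (feasible g e) x z ≤ 0 := hz none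
    rw [hgap, sub_nonpos] at h0
    exact h0.trans (hy.2 hv)
  · rintro ⟨hz, hmin⟩
    refine ⟨fun i => ?_, hz.2⟩
    cases i with
    | none =>
      show valueGap f (feasible g e) x z ≤ 0
      rw [hgap, sub_nonpos]
      exact hmin hy.1
    | some i => exact hz.1 i

theorem isClosed_feasible (hg : ∀ i, Continuous (Function.uncurry (g i)))
    (he : ∀ j, Continuous (Function.uncurry (e j))) (x : E n) : IsClosed (feasible g e x) := by
  have h1 : ∀ i, Continuous (g i x) := fun i => (hg i).comp (Continuous.prodMk_right x)
  have h2 : ∀ j, Continuous (e j x) := fun j => (he j).comp (Continuous.prodMk_right x)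
  have : feasible g e x = (⋂ i, {y | g i x y ≤ 0}) ∩ ⋂ j, {y | e j x y = 0} := by
    ext y; simp [feasible]
  rw [this]
  exact (isClosed_iInter fun i => isClosed_le (h1 i) continuous_const).inter
    (isClosed_iInter fun j => isClosed_eq (h2 j) continuous_const)

theorem solMap_nonempty {x : E n} (hf : Continuous (f x)) (hne : (Γ x).Nonempty)
    (hcl : IsClosed (Γ x)) (hb : LocallyBoundedAt Γ x) : (solMap f Γ x).Nonempty := by
  obtain ⟨B, hB, V, hV, hVB⟩ := hb
  obtain ⟨y, hy, hmin⟩ := (Metric.isCompact_of_isClosed_isBounded hcl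
    (hB.subset (hVB x (mem_of_mem_nhds hV)))).exists_isMinOn hne hf.continuousOn
  exact ⟨y, hy, hmin⟩

/-- Lower semicontinuity of the optimal value under local boundedness. -/
theorem eventually_lt_of_mem_feasible (hf : Continuous (Function.uncurry f))
    (hg : ∀ i, Continuous (Function.uncurry (g i)))
    (he : ∀ j, Continuous (Function.uncurry (e j)))
    (hb : LocallyBoundedAt (feasible g e) x₀) {a : ℝ}
    (ha : ∀ y ∈ feasible g e x₀, a < f x₀ y) :
    ∀ᶠ x in 𝓝 x₀, ∀ y ∈ feasible g e x, a < f x y := by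
  obtain ⟨B, hB, V, hV, hVB⟩ := hb
  -- Tube argument over a compact set: near a feasible `y` the strict inequality persists, near an
  -- infeasible one infeasibility does.
  have htube : ∀ᶠ x in 𝓝 x₀, ∀ y ∈ closure B, y ∈ feasible g e x → a < f x y := by
    refine hB.isCompact_closure.eventually_forall_of_forall_eventually fun y _ => ?_
    by_cases hy : y ∈ feasible g e x₀
    · exact ((hf.tendsto (x₀, y)).eventually (lt_mem_nhds (ha y hy))).mono fun z hz _ => hz
    · have hex : (∃ i, 0 < g i x₀ y) ∨ ∃ j, e j x₀ y ≠ 0 := by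
        by_contra! hcon
        exact hy ⟨hcon.1, hcon.2⟩
      rcases hex with ⟨i, hi⟩ | ⟨j, hj⟩
      · exact (((hg i).tendsto (x₀, y)).eventually (lt_mem_nhds hi)).mono
          fun z hz hmem => absurd (hmem.1 i) (not_le.mpr hz)
      · exact (((he j).tendsto (x₀, y)).eventually (isOpen_ne.mem_nhds hj)).mono
          fun z hz hmem => absurd (hmem.2 j) hz
  filter_upwards [htube, hV] with x hx hxV y hy
  exact hx y (subset_closure (hVB x hxV hy)) hy

/-- Lower semicontinuity of the optimal value, which comes from local boundedness, makes the gap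
upper semicontinuous; the opposite bound is not needed. -/
theorem upperSemicontinuousWithinAt_valueGap (hf : Continuous (Function.uncurry f))
    (hg : ∀ i, Continuous (Function.uncurry (g i)))
    (he : ∀ j, Continuous (Function.uncurry (e j)))
    (hb : LocallyBoundedAt (feasible g e) x₀) (hy₀ : y₀ ∈ solMap f (feasible g e) x₀)
    (hne : ∀ x ∈ Ω, (solMap f (feasible g e) x).Nonempty) :
    UpperSemicontinuousWithinAt (fun z : E n × E m => valueGap f (feasible g e) z.1 z.2)
      (Ω ×ˢ Set.univ) (x₀, y₀) := by
  intro a ha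
  simp only [valueGap_eq_of_mem_solMap hy₀, sub_self] at ha
  have h1 : ∀ᶠ z : E n × E m in 𝓝 (x₀, y₀), f z.1 z.2 < f x₀ y₀ + a / 2 :=
    (hf.tendsto (x₀, y₀)).eventually (gt_mem_nhds (show f x₀ y₀ < f x₀ y₀ + a / 2 by linarith))
  have h2 : ∀ᶠ z : E n × E m in 𝓝 (x₀, y₀), ∀ y ∈ feasible g e z.1, f x₀ y₀ - a / 2 < f z.1 y :=
    (continuous_fst.tendsto (x₀, y₀)).eventually (eventually_lt_of_mem_feasible
      (a := f x₀ y₀ - a / 2) hf hg he hb fun y hy => by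
      have : f x₀ y₀ ≤ f x₀ y := hy₀.2 hy
      linarith)
  filter_upwards [nhdsWithin_le_nhds h1, nhdsWithin_le_nhds h2, self_mem_nhdsWithin] with z hz1 hz2 hz
  obtain ⟨y, hy⟩ := hne z.1 hz.1
  rw [valueGap_eq_of_mem_solMap hy]
  linarith [hz2 y hy.1]

theorem RCPLD.mono {Ω' : Set (E n)} (h : RCPLD g e Ω x₀ y₀) (hsub : Ω' ⊆ Ω) :
    RCPLD g e Ω' x₀ y₀ := by
  obtain ⟨U, hU, S, hS, ⟨r, hr⟩, hK⟩ := h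
  have hs : U ∩ Ω' ×ˢ Set.univ ⊆ U ∩ Ω ×ˢ Set.univ :=
    Set.inter_subset_inter_right _ (Set.prod_mono_left hsub)
  exact ⟨U, hU, S, hS, ⟨r, fun z hz => hr z (hs hz)⟩, fun K hact hpld z hz => hK K hact hpld z (hs hz)⟩

/-- The supremum of a continuous function over an inner semicontinuous mapping is lower
semicontinuous. -/
theorem lowerSemicontinuousOn_pessVal {F : E n → E m → ℝ} (hF : Continuous (Function.uncurry F))
    (hisc : ∀ x ∈ Ω, ∀ y ∈ Γ x, ∀ W ∈ 𝓝 y, ∀ᶠ x' in 𝓝[Ω] x, (Γ x' ∩ W).Nonempty) :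
    LowerSemicontinuousOn (pessVal F Γ) Ω := by
  intro x hx a ha
  simp only [pessVal, lt_iSup_iff] at ha
  obtain ⟨y, hy, hlt⟩ := ha
  have hcont : Continuous fun z : E n × E m => (F z.1 z.2 : EReal) :=
    continuous_coe_real_ereal.comp hF
  have hev := (hcont.tendsto (x, y)).eventually (lt_mem_nhds hlt)
  rw [nhds_prod_eq] at hev
  obtain ⟨A, hA, W, hW, hAW⟩ := mem_prod_iff.mp hev
  filter_upwards [hisc x hx y hy W hW, nhdsWithin_le_nhds hA] with x' hx' hxA
  obtain ⟨y', hy', hyW⟩ := hx'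
  exact (hAW (Set.mk_mem_prod hxA hyW)).trans_le (le_iSup₂ (f := fun y _ => (F x' y : EReal)) y' hy')

end Solutions
end Bilevel

/-! ### Existence of a pessimistic solution -/

theorem mainTheorem6 (n m l q : ℕ)
    (F f : Bilevel.E n → Bilevel.E m → ℝ)
    (g : Fin l → Bilevel.E n → Bilevel.E m → ℝ)
    (e : Fin q → Bilevel.E n → Bilevel.E m → ℝ)
    (X : Set (Bilevel.E n))
    (hF : ContDiff ℝ 1 (Function.uncurry F))
    (hf : ContDiff ℝ 1 (Function.uncurry f))
    (hg : ∀ i, ContDiff ℝ 1 (Function.uncurry (g i)))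
    (he : ∀ j, ContDiff ℝ 1 (Function.uncurry (e j)))
    (hf_conv : ∀ x, ConvexOn ℝ Set.univ (f x))
    (hg_conv : ∀ i x, ConvexOn ℝ Set.univ (g i x))
    (he_aff : ∀ j x, ∃ A : Bilevel.E m →ᵃ[ℝ] ℝ, ∀ y, e j x y = A y)
    (hX_dom : X ⊆ Bilevel.dom (Bilevel.feasible g e))
    (hX_bdd : ∀ x ∈ X, Bilevel.LocallyBoundedAt (Bilevel.feasible g e) x)
    (hX_rcpld : ∀ z ∈ Bilevel.gph (Bilevel.solMap f (Bilevel.feasible g e)) ∩ X ×ˢ Set.univ,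
      Bilevel.RCPLD (Bilevel.solIneq f g e) e (Bilevel.dom (Bilevel.feasible g e)) z.1 z.2)
    (hX_ne : X.Nonempty) (hX_cpt : IsCompact X) :
    ∃ x₀, Bilevel.IsPessimisticSolution F (Bilevel.solMap f (Bilevel.feasible g e)) X x₀ := by
  open Bilevel in
  have hfd := differentiable_slice hf
  have hS_ne : ∀ x ∈ X, (solMap f (feasible g e) x).Nonempty := fun x hx =>
    solMap_nonempty (hfd x).continuous (hX_dom hx)
      (isClosed_feasible (fun i => (hg i).continuous) (fun j => (he j).continuous) x) (hX_bdd x hx)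
  have hfeas : ∀ x ∈ X, feasible (solIneq f g e) e x = solMap f (feasible g e) x := fun x hx =>
    feasible_solIneq_eq_solMap (hS_ne x hx)
  have hlsc : LowerSemicontinuousOn (pessVal F (solMap f (feasible g e))) X := by
    refine lowerSemicontinuousOn_pessVal hF.continuous fun x hx y hy W hW => ?_
    -- The parameter set shrinks from the domain to `X`: `hS_ne` gives solvability of the system
    -- only on `X`.
    have hisc := ((hX_rcpld (x, y) ⟨hy, hx, Set.mem_univ y⟩).mono
      hX_dom).eventually_feasible_inter_nonempty (W := W)
      (by
        rintro (_ | i) x'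
        · exact (hfd x').sub_const _
        · exact differentiable_slice (hg i) x')
      (fun j => differentiable_slice (he j))
      (by
        rintro (_ | i) x'
        · exact (hf_conv x').sub (concaveOn_const _ convex_univ)
        · exact hg_conv i x')
      he_aff
      (by
        rintro (_ | i)
        · simp only [solIneq, gradY_valueGap hfd]
          exact (continuous_gradY hf).continuousAt
        · exact (continuous_gradY (hg i)).continuousAt)
      (fun j => (continuous_gradY (he j)).continuousAt)
      (by
        rintro (_ | i)
        · exact upperSemicontinuousWithinAt_valueGap hf.continuous (fun i => (hg i).continuous)
            (fun j => (he j).continuous) (hX_bdd x hx) hy hS_ne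
        · exact (hg i).continuous.continuousWithinAt.upperSemicontinuousWithinAt)
      (fun j => (he j).continuous.continuousAt) hx (by rwa [hfeas x hx])
      (fun x' hx' => by rw [hfeas x' hx']; exact hS_ne x' hx') hW
    filter_upwards [hisc, self_mem_nhdsWithin] with x' hx' hxX
    rwa [hfeas x' hxX] at hx'
  obtain ⟨x₀, hx₀, hmin⟩ := hlsc.exists_isMinOn hX_ne hX_cpt
  exact ⟨x₀, hx₀, hmin⟩
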